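/- In the Majority Model (MM) on a graph, every node is blue or white, and in each round all nodes simultaneously adopt the most frequent color among their neighbors, a node keeping its own color in case of a tie. A coloring is stable if one round of MM leaves it unchanged. A $p$-random coloring colors each node blue independently with probability $p$, and white otherwise. Theorem. There is an absolute constant $C>0$ such that for every $\varepsilon>0$ and every $\delta>0$ there is an $N$ such that for all $n\ge N$ and all $p\in[1/2,1]$ the following holds. With probability at least $1-\delta$, MM on the cycle $C_n$ started from a $p$-random coloring reaches, after at most $C\log n$ rounds, a stable coloring whose number $b$ of blue nodes satisfies $$(1-\varepsilon)\,\frac{2p^2-p^3}{1-p+p^2}\,n\;\le\; b\;\le\;(1+\varepsilon)\,\frac{2p^2-p^3}{1-p+p^2}\,n .$$ In particular, for every fixed $p \in [1/2,1]$ and $\varepsilon>0$ this event has probability $1-o(1)$ as $n\to\infty$. -/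

import Mathlib

namespace MajorityModel

/-- A colouring of the nodes with two colours: `true` is blue, `false` is white. -/
abbrev Coloring (V : Type*) := V → Bool

/-- The number of neighbours of `v` that have colour `a` in the colouring `c`. -/
def nbrCount {V : Type*} [Fintype V] (G : SimpleGraph V) [DecidableRel G.Adj]
    (c : Coloring V) (a : Bool) (v : V) : ℕ :=
  ((G.neighborFinset v).filter (fun u => c u = a)).card

/-- One synchronous round of the Majority Model: every node takes the most frequent colour in its
neighbourhood and keeps its own colour in case of a tie. -/
def step {V : Type*} [Fintype V] (G : SimpleGraph V) [DecidableRel G.Adj]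
    (c : Coloring V) : Coloring V := fun v =>
  if nbrCount G c true v = nbrCount G c false v then c v
  else if nbrCount G c false v < nbrCount G c true v then true
  else false

/-- The colouring after `t` rounds of the Majority Model started from `c`. -/
def run {V : Type*} [Fintype V] (G : SimpleGraph V) [DecidableRel G.Adj]
    (c : Coloring V) (t : ℕ) : Coloring V :=
  (step G)^[t] c

/-- A colouring is stable if one round of the Majority Model does not change it. -/
def IsStable {V : Type*} [Fintype V] (G : SimpleGraph V) [DecidableRel G.Adj]
    (c : Coloring V) : Prop :=
  step G c = c

/-- The number of blue nodes of a colouring. -/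
def blueCount {V : Type*} [Fintype V] (c : Coloring V) : ℕ :=
  (Finset.univ.filter (fun v => c v = true)).card

/-- The law of the `p`-random colouring: every node is blue with probability `p` and white with
probability `1 - p`, independently. -/
noncomputable def randomColoring (V : Type*) [Fintype V] (p : unitInterval) :
    MeasureTheory.Measure (Coloring V) :=
  MeasureTheory.Measure.pi (fun _ : V => ProbabilityTheory.bernoulliMeasure true false p)

/-- The limiting proportion `(2p² - p³) / (1 - p + p²)` of blue nodes. -/
noncomputable def blueDensity (p : ℝ) : ℝ :=
  (2 * p ^ 2 - p ^ 3) / (1 - p + p ^ 2)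

end MajorityModel

/-!
On a cycle a node and its two neighbours vote, so a node changes colour exactly when both neighbours
differ from it, and two adjacent nodes of the same colour are frozen for ever. Lifting colourings to
periodic colourings of `ℤ`, the maximal alternating intervals shrink by one node at either end in
each round (`altOn_lineStep_iff`). Hence a node changes colour in round `t + 1` if and only if the
initial colouring alternates on the `2 * t + 3` nodes around it (`lineStep_iterate_succ_ne_iff`),
and it then takes the colour of the two end points of that interval (`lineStep_iterate_of_altOn`).

With `q = 1 - p`, such an interval has blue end points with probability `p * (p * q) ^ (t + 1)` and
white ones with probability `q * (p * q) ^ (t + 1)`, as long as it does not wrap around the cycle.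

* The union bound over its centre shows that the colouring after `t` rounds fails to be stable with
  probability at most `n * (1 / 4) ^ (t + 1)` (`randomColoring_not_isStable_le`).
* The probability `f t` that a node is blue after `t` rounds satisfies `f 0 = p` and
  `f (t + 1) = f t + (p - q) * (p * q) ^ (t + 1)`. The limit of this geometric series is
  `p + (p - q) * p * q / (1 - p * q)`, which is `blueDensity p`, and the error after `t` rounds is
  at most `(1 / 4) ^ t` (`abs_randomColoring_run_sub_le`).
* The colours of two nodes after `t` rounds are independent unless the nodes are at distance at most
  `2 * t`, so the number of blue nodes has variance at most `n * (4 * t + 1)`, and Chebyshev's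
  inequality applies (`randomColoring_blueCount_deviation_le`).

Taking `t = ⌊2 * log n⌋` makes all three errors negligible, uniformly in `p`. As `blueDensity p` is
at least `1 / 2` for `p ≥ 1 / 2`, the additive error `ε * n / 2` is at most the relative error `ε`.
-/

namespace MajorityModel

/-! ### The dynamics on the integer line -/

/-- One round of the Majority Model on the two-way infinite path `ℤ`. -/
def lineStep (x : ℤ → Bool) : ℤ → Bool := fun j =>
  if x (j - 1) = x (j + 1) then x (j + 1) else x j

/-- The colouring `x` alternates on the integer interval `[a, b]`. -/
def AltOn (x : ℤ → Bool) (a b : ℤ) : Prop :=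
  ∀ j, a ≤ j → j < b → x (j + 1) = !x j

lemma lineStep_ne_iff (x : ℤ → Bool) (j : ℤ) :
    lineStep x j ≠ x j ↔ AltOn x (j - 1) (j + 1) := by
  constructor
  · intro h i hi hi'
    have key : ∀ a e b : Bool, (if a = b then b else e) ≠ e → e = !a ∧ b = !e := by decide
    obtain ⟨h1, h2⟩ := key _ _ _ h
    obtain rfl | rfl : i = j - 1 ∨ i = j := by omega
    · rw [sub_add_cancel, h1]
    · exact h2
  · intro h
    have h1 := h (j - 1) le_rfl (by omega)
    have h2 := h j (by omega) (by omega)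
    rw [sub_add_cancel] at h1
    unfold lineStep
    revert h1 h2
    cases x (j - 1) <;> cases x j <;> cases x (j + 1) <;> simp_all

lemma lineStep_eq_of_altOn {x : ℤ → Bool} {j : ℤ} (h : AltOn x (j - 1) (j + 1)) :
    lineStep x j = x (j + 1) := by
  have h1 := (lineStep_ne_iff x j).2 h
  have h2 := h j (by omega) (by omega)
  revert h1 h2
  cases lineStep x j <;> cases x j <;> cases x (j + 1) <;> simp_all

lemma AltOn.mono {x : ℤ → Bool} {a b a' b' : ℤ} (h : AltOn x a b) (ha : a ≤ a') (hb : b' ≤ b) :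
    AltOn x a' b' := fun j h1 h2 => h j (by omega) (by omega)

/-- Two equal neighbours keep their colour. -/
lemma lineStep_of_eq {x : ℤ → Bool} {j : ℤ} (h : x (j + 1) = x j) :
    lineStep x j = x j ∧ lineStep x (j + 1) = x (j + 1) := by
  have e : j + 1 - 1 = j := by ring
  unfold lineStep
  rw [e]
  revert h
  cases x (j - 1) <;> cases x j <;> cases x (j + 1) <;> cases x (j + 1 + 1) <;> simp_all

/-- One round shortens an alternating interval by exactly one node at either end, as long as at least
three nodes are left. For two nodes this fails: two blocks of different colours meet in an
alternating pair that persists. -/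
lemma altOn_lineStep_iff (x : ℤ → Bool) {a b : ℤ} (hab : a + 1 < b) :
    AltOn (lineStep x) a b ↔ AltOn x (a - 1) (b + 1) := by
  constructor
  · intro h
    -- a node that differs from its neighbour after the round differed from it before
    have hin : AltOn x a b := by
      intro j h1 h2
      by_contra hne
      have he : x (j + 1) = x j := by
        revert hne; cases x (j + 1) <;> cases x j <;> simp
      obtain ⟨e1, e2⟩ := lineStep_of_eq he
      have := h j h1 h2
      rw [e1, e2, he] at this
      simp at this
    intro j h1 h2
    obtain hj | hj | hj : (a ≤ j ∧ j < b) ∨ j = a - 1 ∨ j = b := by omega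
    · exact hin j hj.1 hj.2
    · subst hj
      by_contra hne
      have he : x (a - 1 + 1) = x (a - 1) := by
        revert hne; cases x (a - 1 + 1) <;> cases x (a - 1) <;> simp
      have e2 := (lineStep_of_eq he).2
      rw [sub_add_cancel] at e2
      have e3 := lineStep_eq_of_altOn (x := x) (j := a + 1) (hin.mono (by omega) (by omega))
      have e4 := hin (a + 1) (by omega) (by omega)
      have e5 := hin a (by omega) (by omega)
      have e6 := h a (by omega) (by omega)
      rw [e2, e3, e4, e5] at e6
      simp at e6
    · subst hj
      by_contra hne
      have he : x (j + 1) = x j := by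
        revert hne; cases x (j + 1) <;> cases x j <;> simp
      have e1 := (lineStep_of_eq he).1
      have e3 := lineStep_eq_of_altOn (x := x) (j := j - 1) (hin.mono (by omega) (by omega))
      have e6 := h (j - 1) (by omega) (by omega)
      rw [e3, sub_add_cancel, e1] at e6
      simp at e6
  · intro h j h1 h2
    rw [lineStep_eq_of_altOn (h.mono (by omega) (by omega)),
      lineStep_eq_of_altOn (h.mono (by omega) (by omega))]
    exact h (j + 1) (by omega) (by omega)

/-- A node changes its colour in round `t + 1` if and only if it is the centre of an interval of
`2 * t + 3` nodes on which the initial colouring alternates. -/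
lemma lineStep_iterate_succ_ne_iff (t : ℕ) (x : ℤ → Bool) (v : ℤ) :
    lineStep^[t + 1] x v ≠ lineStep^[t] x v ↔ AltOn x (v - (t + 1 : ℕ)) (v + (t + 1 : ℕ)) := by
  induction t generalizing x with
  | zero => simpa using lineStep_ne_iff x v
  | succ t ih =>
    have h1 := Function.iterate_succ_apply lineStep (t + 1) x
    have h2 := Function.iterate_succ_apply lineStep t x
    rw [h1, h2, ih,
      altOn_lineStep_iff _ (by omega)]
    congr! 1 <;> omega

/-- At the centre of an alternating interval of `2 * t + 1` nodes, the colour after `t` rounds is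
that of the end points. -/
lemma lineStep_iterate_of_altOn (t : ℕ) (x : ℤ → Bool) (v : ℤ) (h : AltOn x (v - t) (v + t)) :
    lineStep^[t] x v = x (v + t) := by
  induction t generalizing x with
  | zero => simp
  | succ t ih =>
    have h' : AltOn (lineStep x) (v - t) (v + t) := by
      intro j h1 h2
      rw [lineStep_eq_of_altOn (h.mono (by omega) (by omega)),
        lineStep_eq_of_altOn (h.mono (by omega) (by omega))]
      exact h (j + 1) (by omega) (by omega)
    rw [Function.iterate_succ_apply, ih _ h',
      lineStep_eq_of_altOn (h.mono (by omega) (by omega))]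
    congr 1
    omega

/-- The colour of a node after `t` rounds depends only on the nodes at distance at most `t`. -/
lemma lineStep_iterate_congr (t : ℕ) (x y : ℤ → Bool) (v : ℤ)
    (h : ∀ j, v - t ≤ j → j ≤ v + t → x j = y j) :
    lineStep^[t] x v = lineStep^[t] y v := by
  induction t generalizing x y with
  | zero => exact h v (by simp) (by simp)
  | succ t ih =>
    rw [Function.iterate_succ_apply, Function.iterate_succ_apply]
    refine ih _ _ fun j h1 h2 => ?_
    simp only [lineStep, h j (by omega) (by omega), h (j - 1) (by omega) (by omega),
      h (j + 1) (by omega) (by omega)]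

/-- The alternating pattern of `2 * t + 1` nodes centred at `v` whose end points have colour `a`. -/
def AltPattern (x : ℤ → Bool) (v : ℤ) (t : ℕ) (a : Bool) : Prop :=
  ∀ i : ℕ, i < 2 * t + 1 → x (v - t + i) = if i % 2 = 0 then a else !a

lemma altPattern_iff (x : ℤ → Bool) (v : ℤ) (t : ℕ) (a : Bool) :
    AltPattern x v t a ↔ AltOn x (v - t) (v + t) ∧ x (v + t) = a := by
  constructor
  · intro h
    constructor
    · intro j h1 h2
      obtain ⟨i, rfl⟩ : ∃ i : ℕ, j = v - t + i := ⟨(j - (v - t)).toNat, by omega⟩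
      have e1 := h i (by omega)
      have e2 := h (i + 1) (by omega)
      push_cast at e2
      rw [← add_assoc] at e2
      rw [e1, e2]
      rcases Nat.mod_two_eq_zero_or_one i with hi | hi
      · rw [if_neg (by omega), if_pos hi]
      · rw [if_pos (by omega), if_neg (by omega), Bool.not_not]
    · have := h (2 * t) (by omega)
      rw [if_pos (by omega)] at this
      rw [← this]
      congr 1
      push_cast
      ring
  · rintro ⟨h, rfl⟩ i hi
    -- downward induction from the right end point
    obtain ⟨k, hk⟩ : ∃ k : ℕ, i + k = 2 * t := ⟨2 * t - i, by omega⟩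
    clear hi
    induction k generalizing i with
    | zero =>
      rw [if_pos (by omega)]
      congr 1
      omega
    | succ k ih =>
      have e := ih (i + 1) (by omega)
      have e' := h (v - t + i) (by omega) (by omega)
      push_cast at e
      rw [← add_assoc, e'] at e
      rcases Nat.mod_two_eq_zero_or_one i with hi | hi
      · rw [if_neg (by omega)] at e
        rw [if_pos hi]
        simpa using e
      · rw [if_pos (by omega)] at e
        rw [if_neg (by omega), ← e, Bool.not_not]

/-! ### Unrolling the cycle -/

/-- The covering map from `ℤ` to the nodes of the cycle. -/
def site (m : ℕ) (j : ℤ) : Fin (m + 3) := ((j : ZMod (m + 3)) : ZMod (m + 3))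

lemma site_add_one (m : ℕ) (j : ℤ) : site m (j + 1) = site m j + 1 :=
  show ((j + 1 : ℤ) : ZMod (m + 3)) = (j : ZMod (m + 3)) + 1 by push_cast; rfl

lemma site_sub_one (m : ℕ) (j : ℤ) : site m (j - 1) = site m j - 1 :=
  show ((j - 1 : ℤ) : ZMod (m + 3)) = (j : ZMod (m + 3)) - 1 by push_cast; rfl

lemma site_eq_iff (m : ℕ) (i j : ℤ) : site m i = site m j ↔ ((m + 3 : ℕ) : ℤ) ∣ j - i :=
  ZMod.intCast_eq_intCast_iff_dvd_sub i j (m + 3)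

lemma exists_site_eq (m : ℕ) (v : Fin (m + 3)) : ∃ j : ℤ, site m j = v :=
  ZMod.intCast_surjective (n := m + 3) v

/-- The periodic colouring of `ℤ` that lifts a colouring of the cycle. -/
def unroll {m : ℕ} (c : Coloring (Fin (m + 3))) : ℤ → Bool := fun j => c (site m j)

lemma step_cycleGraph {m : ℕ} [DecidableRel (SimpleGraph.cycleGraph (m + 3)).Adj]
    (c : Coloring (Fin (m + 3))) (v : Fin (m + 3)) :
    step (SimpleGraph.cycleGraph (m + 3)) c v =
      if c (v - 1) = c (v + 1) then c (v + 1) else c v := by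
  have hN : (SimpleGraph.cycleGraph (m + 3)).neighborFinset v = {v - 1, v + 1} := by
    rw [← SimpleGraph.cycleGraph_neighborFinset]
    congr!
  have hne : v - 1 ≠ v + 1 := by
    obtain ⟨j, rfl⟩ := exists_site_eq m v
    rw [← site_add_one, ← site_sub_one, Ne, site_eq_iff]
    intro h
    have := Int.le_of_dvd (by omega) h
    push_cast at this
    omega
  unfold step nbrCount
  rw [hN]
  simp only [Finset.filter_insert, Finset.filter_singleton]
  cases c (v - 1) <;> cases c (v + 1) <;> simp [hne]

lemma unroll_step {m : ℕ} [DecidableRel (SimpleGraph.cycleGraph (m + 3)).Adj]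
    (c : Coloring (Fin (m + 3))) :
    unroll (step (SimpleGraph.cycleGraph (m + 3)) c) = lineStep (unroll c) := by
  funext j
  simp only [unroll, lineStep, step_cycleGraph, site_add_one, site_sub_one]

lemma unroll_run {m : ℕ} [DecidableRel (SimpleGraph.cycleGraph (m + 3)).Adj]
    (c : Coloring (Fin (m + 3))) (t : ℕ) :
    unroll (run (SimpleGraph.cycleGraph (m + 3)) c t) = lineStep^[t] (unroll c) := by
  induction t with
  | zero => rfl
  | succ t ih =>
    rw [run, Function.iterate_succ_apply', unroll_step, Function.iterate_succ_apply', ← ih, run]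

open MeasureTheory ProbabilityTheory

/-! ### Random colourings -/

/-- The probability that a given node of a `p`-random colouring has colour `a`. -/
def colorProb (p : unitInterval) (a : Bool) : ℝ := if a then p else 1 - p

instance (V : Type*) [Fintype V] (p : unitInterval) :
    IsProbabilityMeasure (randomColoring V p) := by
  unfold randomColoring; infer_instance

lemma randomColoring_eval {V : Type*} [Fintype V] (p : unitInterval) (v : V) (a : Bool) :
    (randomColoring V p).real {c | c v = a} = colorProb p a := by
  have h : MeasurePreserving (Function.eval v) (randomColoring V p)
      (bernoulliMeasure true false p) :=
    measurePreserving_eval (fun _ : V => bernoulliMeasure true false p) v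
  have h2 := h.measureReal_preimage (s := ({a} : Set Bool))
    (MeasurableSet.singleton a).nullMeasurableSet
  rw [bernoulliMeasure_real_apply _ (MeasurableSet.singleton a)] at h2
  refine h2.trans ?_
  cases a <;> simp [colorProb]

lemma randomColoring_iIndepFun (V : Type*) [Fintype V] (p : unitInterval) :
    iIndepFun (fun (v : V) (c : Coloring V) => c v) (randomColoring V p) :=
  iIndepFun_pi (X := fun _ => id) fun _ => aemeasurable_id

/-- The probability that a random colouring shows the colours `b 0, …, b (k - 1)` at distinct nodes
`s 0, …, s (k - 1)`. -/
lemma randomColoring_cylinder {V : Type*} [Fintype V] (p : unitInterval) (k : ℕ) (s : ℕ → V)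
    (hs : Set.InjOn s (Set.Iio k)) (b : ℕ → Bool) :
    (randomColoring V p).real {c | ∀ i, i < k → c (s i) = b i} =
      ∏ i ∈ Finset.range k, colorProb p (b i) := by
  classical
  have hind : iIndepFun (fun (i : Fin k) (c : Coloring V) => c (s i)) (randomColoring V p) :=
    (randomColoring_iIndepFun V p).precomp (g := fun i : Fin k => s i)
      (fun i j h => Fin.ext (hs i.2 j.2 h))
  have h := hind.meas_iInter (s := fun i : Fin k => {c : Coloring V | c (s i) = b i})
    (fun i => ⟨{b i}, MeasurableSet.singleton _, rfl⟩)
  have hset : {c : Coloring V | ∀ i, i < k → c (s i) = b i} =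
      ⋂ i : Fin k, {c | c (s i) = b i} := by
    ext c
    simp only [Set.mem_ofPred_eq, Set.mem_iInter]
    exact ⟨fun h i => h i i.2, fun h i hi => h ⟨i, hi⟩⟩
  rw [hset, measureReal_def, h, ENNReal.toReal_prod, Finset.prod_range]
  exact Finset.prod_congr rfl fun i _ => randomColoring_eval p (s i) (b i)

lemma prod_colorProb_alternating (p : unitInterval) (t : ℕ) (a : Bool) :
    ∏ i ∈ Finset.range (2 * t + 1), colorProb p (if i % 2 = 0 then a else !a) =
      colorProb p a * ((p : ℝ) * (1 - p)) ^ t := by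
  induction t with
  | zero => simp
  | succ t ih =>
    rw [show 2 * (t + 1) + 1 = 2 * t + 1 + 1 + 1 by ring, Finset.prod_range_succ,
      Finset.prod_range_succ, ih, if_neg (by omega), if_pos (by omega)]
    cases a <;> simp [colorProb] <;> ring

lemma randomColoring_altPattern {m : ℕ} (p : unitInterval) (v : ℤ) (t : ℕ) (a : Bool)
    (ht : 2 * t + 1 ≤ m + 3) :
    (randomColoring (Fin (m + 3)) p).real {c | AltPattern (unroll c) v t a} =
      colorProb p a * ((p : ℝ) * (1 - p)) ^ t := by
  rw [← prod_colorProb_alternating]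
  refine randomColoring_cylinder p (2 * t + 1) (fun i : ℕ => site m (v - t + i)) ?_ _
  intro i hi j hj h
  simp only [Set.mem_Iio] at hi hj
  obtain ⟨d, hd⟩ := (site_eq_iff m _ _).1 h
  have h1 : d < 1 := by
    by_contra hcon
    have : ((m + 3 : ℕ) : ℤ) * 1 ≤ ((m + 3 : ℕ) : ℤ) * d :=
      mul_le_mul_of_nonneg_left (by omega) (by omega)
    omega
  have h2 : -1 < d := by
    by_contra hcon
    have : ((m + 3 : ℕ) : ℤ) * d ≤ ((m + 3 : ℕ) : ℤ) * (-1) :=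
      mul_le_mul_of_nonneg_left (by omega) (by omega)
    omega
  obtain rfl : d = 0 := by omega
  omega

/-- The probability that a given node is blue after `t` rounds satisfies a first-order recursion:
the change in round `t + 1` comes from the two alternating patterns of `2 * t + 3` nodes around
that node. -/
lemma randomColoring_run_succ {m : ℕ} (p : unitInterval) (v : ℤ) (t : ℕ)
    (ht : 2 * t + 3 ≤ m + 3) :
    (randomColoring (Fin (m + 3)) p).real {c | lineStep^[t + 1] (unroll c) v = true} =
      (randomColoring (Fin (m + 3)) p).real {c | lineStep^[t] (unroll c) v = true} +
        (2 * p - 1) * ((p : ℝ) * (1 - p)) ^ (t + 1) := by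
  set μ := randomColoring (Fin (m + 3)) p
  set A : Set (Coloring (Fin (m + 3))) := {c | lineStep^[t] (unroll c) v = true}
  set B : Set (Coloring (Fin (m + 3))) := {c | AltPattern (unroll c) v (t + 1) true}
  set W : Set (Coloring (Fin (m + 3))) := {c | AltPattern (unroll c) v (t + 1) false}
  have key : ∀ (c : Coloring (Fin (m + 3))) (a : Bool), AltPattern (unroll c) v (t + 1) a →
      lineStep^[t + 1] (unroll c) v = a ∧ lineStep^[t] (unroll c) v = !a := by
    intro c a h
    obtain ⟨h1, h2⟩ := (altPattern_iff _ _ _ _).1 h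
    have h3 := (lineStep_iterate_succ_ne_iff t (unroll c) v).2 h1
    have h4 := lineStep_iterate_of_altOn (t + 1) _ _ h1
    rw [h2] at h4
    rw [h4] at h3
    exact ⟨h4, by revert h3; cases a <;> simp⟩
  have hWA : W ⊆ A := fun c hc => (key c false hc).2
  have hBA : Disjoint (A \ W) B := by
    rw [Set.disjoint_left]
    rintro c ⟨hc, -⟩ hB
    have := (key c true hB).2
    rw [show lineStep^[t] (unroll c) v = true from hc] at this
    simp at this
  have hset : {c : Coloring (Fin (m + 3)) | lineStep^[t + 1] (unroll c) v = true} = A \ W ∪ B := by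
    ext c
    constructor
    · intro hc
      by_cases hA : c ∈ A
      · refine Or.inl ⟨hA, fun hW => ?_⟩
        have := (key c false hW).1
        rw [show lineStep^[t + 1] (unroll c) v = true from hc] at this
        simp at this
      · right
        have hne : lineStep^[t + 1] (unroll c) v ≠ lineStep^[t] (unroll c) v := fun h =>
          hA (h.symm.trans hc)
        have h1 := (lineStep_iterate_succ_ne_iff t (unroll c) v).1 hne
        exact (altPattern_iff _ _ _ _).2 ⟨h1, (lineStep_iterate_of_altOn _ _ _ h1).symm.trans hc⟩
    · rintro (⟨hA, hW⟩ | hB)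
      · by_contra hc
        refine hW ?_
        have hne : lineStep^[t + 1] (unroll c) v ≠ lineStep^[t] (unroll c) v := fun h =>
          hc (h.trans hA)
        have h1 := (lineStep_iterate_succ_ne_iff t (unroll c) v).1 hne
        exact (altPattern_iff _ _ _ _).2
          ⟨h1, (lineStep_iterate_of_altOn _ _ _ h1).symm.trans (by simpa using hc)⟩
      · exact (key c true hB).1
  have hB : μ.real B = _ := randomColoring_altPattern p v (t + 1) true (by omega)
  have hW : μ.real W = _ := randomColoring_altPattern p v (t + 1) false (by omega)
  rw [hset, measureReal_union hBA (Set.toFinite B).measurableSet,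
    measureReal_sdiff hWA (Set.toFinite W).measurableSet, hB, hW]
  simp only [colorProb]
  simp
  ring

lemma mul_one_sub_le_quarter (p : unitInterval) : (p : ℝ) * (1 - p) ≤ 1 / 4 := by
  nlinarith [sq_nonneg ((p : ℝ) - 1 / 2)]

lemma mul_one_sub_nonneg (p : unitInterval) : 0 ≤ (p : ℝ) * (1 - p) :=
  mul_nonneg p.2.1 (by linarith [p.2.2])

lemma one_sub_mul_blueDensity (p : ℝ) :
    (1 - p * (1 - p)) * blueDensity p = 2 * p ^ 2 - p ^ 3 := by
  have : 1 - p + p ^ 2 ≠ 0 := by nlinarith [sq_nonneg (p - 1 / 2)]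
  unfold blueDensity
  field_simp
  ring

/-- The geometric series given by the recursion `randomColoring_run_succ`, summed. -/
lemma randomColoring_run_eq {m : ℕ} (p : unitInterval) (v : ℤ) (t : ℕ)
    (ht : 2 * t + 1 ≤ m + 3) :
    (1 - (p : ℝ) * (1 - p)) *
      (blueDensity p -
        (randomColoring (Fin (m + 3)) p).real {c | lineStep^[t] (unroll c) v = true}) =
      (2 * p - 1) * ((p : ℝ) * (1 - p)) ^ (t + 1) := by
  induction t with
  | zero =>
    have := randomColoring_eval p (site m v) true
    simp only [colorProb, if_true] at this
    simp only [Function.iterate_zero, id, unroll]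
    rw [this, mul_sub, one_sub_mul_blueDensity]
    ring
  | succ t ih =>
    have := ih (by omega)
    rw [randomColoring_run_succ p v t (by omega), ← sub_sub, mul_sub, this]
    ring

lemma abs_randomColoring_run_sub_le {m : ℕ} (p : unitInterval) (v : ℤ) (t : ℕ)
    (ht : 2 * t + 1 ≤ m + 3) :
    |(randomColoring (Fin (m + 3)) p).real {c | lineStep^[t] (unroll c) v = true} -
      blueDensity p| ≤ (1 / 4) ^ t := by
  have h := randomColoring_run_eq p v t ht
  set f := (randomColoring (Fin (m + 3)) p).real {c | lineStep^[t] (unroll c) v = true}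
  have h1 := mul_one_sub_le_quarter p
  have h0 := mul_one_sub_nonneg p
  have h2 : ((p : ℝ) * (1 - p)) ^ t ≤ (1 / 4) ^ t := pow_le_pow_left₀ h0 h1 t
  have h3 : |2 * (p : ℝ) - 1| ≤ 1 := abs_le.2 ⟨by linarith [p.2.1], by linarith [p.2.2]⟩
  have h4 : (1 - (p : ℝ) * (1 - p)) * |f - blueDensity p| =
      |2 * (p : ℝ) - 1| * (((p : ℝ) * (1 - p)) ^ t * (p * (1 - p))) := by
    rw [abs_sub_comm f, ← pow_succ, ← abs_of_nonneg (pow_nonneg h0 (t + 1)), ← abs_mul, ← h,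
      abs_mul, abs_of_nonneg (show 0 ≤ 1 - (p : ℝ) * (1 - p) by linarith)]
  have h5 : |2 * (p : ℝ) - 1| * (((p : ℝ) * (1 - p)) ^ t * (p * (1 - p))) ≤
      1 * ((1 / 4) ^ t * (1 / 4)) := by gcongr
  have h6 : 3 / 4 * |f - blueDensity p| ≤ (1 - (p : ℝ) * (1 - p)) * |f - blueDensity p| :=
    mul_le_mul_of_nonneg_right (by linarith) (abs_nonneg _)
  have h7 : (0 : ℝ) ≤ (1 / 4) ^ t := by positivity
  linarith

lemma half_le_blueDensity (p : unitInterval) (hp : 1 / 2 ≤ (p : ℝ)) :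
    1 / 2 ≤ blueDensity p := by
  have h1 := p.2.2
  unfold blueDensity
  rw [le_div_iff₀ (by nlinarith)]
  nlinarith [mul_nonneg (mul_nonneg p.2.1 (sub_nonneg.2 h1)) (sub_nonneg.2 hp)]

/-! ### Stabilisation -/

/-- The colouring is not yet stable after `t` rounds only if the initial colouring alternates
on some interval of `2 * t + 3` nodes; a union bound over the centre of that interval. -/
lemma randomColoring_not_isStable_le {m : ℕ}
    [DecidableRel (SimpleGraph.cycleGraph (m + 3)).Adj] (p : unitInterval) (t : ℕ)
    (ht : 2 * t + 3 ≤ m + 3) :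
    (randomColoring (Fin (m + 3)) p).real
      {c | ¬ IsStable (SimpleGraph.cycleGraph (m + 3))
        (run (SimpleGraph.cycleGraph (m + 3)) c t)} ≤ (m + 3 : ℕ) * (1 / 4) ^ (t + 1) := by
  set μ := randomColoring (Fin (m + 3)) p
  choose l hl using exists_site_eq m
  have hsub : {c | ¬ IsStable (SimpleGraph.cycleGraph (m + 3))
        (run (SimpleGraph.cycleGraph (m + 3)) c t)} ⊆
      ⋃ v ∈ (Finset.univ : Finset (Fin (m + 3))),
        ({c | AltPattern (unroll c) (l v) (t + 1) true} ∪
          {c | AltPattern (unroll c) (l v) (t + 1) false}) := by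
    intro c hc
    obtain ⟨v, hv⟩ : ∃ v, step (SimpleGraph.cycleGraph (m + 3))
        (run (SimpleGraph.cycleGraph (m + 3)) c t) v ≠
          run (SimpleGraph.cycleGraph (m + 3)) c t v := Function.ne_iff.1 hc
    have e1 := congrFun (unroll_run c t) (l v)
    have e2 := congrFun (unroll_run c (t + 1)) (l v)
    rw [run, Function.iterate_succ_apply'] at e2
    simp only [unroll, hl] at e1 e2
    have hne : lineStep^[t + 1] (unroll c) (l v) ≠ lineStep^[t] (unroll c) (l v) := by
      rw [show lineStep^[t + 1] (unroll c) (l v) = _ from e2.symm,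
        show lineStep^[t] (unroll c) (l v) = _ from e1.symm]
      exact hv
    have h1 := (lineStep_iterate_succ_ne_iff t _ _).1 hne
    simp only [Finset.mem_univ, Set.iUnion_true, Set.mem_iUnion]
    refine ⟨v, ?_⟩
    rcases hx : unroll c (l v + (t + 1 : ℕ)) with _ | _
    · exact Or.inr ((altPattern_iff _ _ _ _).2 ⟨h1, hx⟩)
    · exact Or.inl ((altPattern_iff _ _ _ _).2 ⟨h1, hx⟩)
  refine (measureReal_mono hsub (measure_ne_top μ _)).trans ((measureReal_biUnion_finset_le _ _).trans ?_)
  refine (Finset.sum_le_card_nsmul _ _ ((1 / 4) ^ (t + 1)) fun v _ => ?_).trans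
    (by simp)
  refine (measureReal_union_le _ _).trans ?_
  rw [randomColoring_altPattern p _ _ _ (by omega), randomColoring_altPattern p _ _ _ (by omega),
    ← add_mul]
  have : colorProb p true + colorProb p false = 1 := by simp [colorProb]
  rw [this, one_mul]
  exact pow_le_pow_left₀ (mul_one_sub_nonneg p) (mul_one_sub_le_quarter p) _

/-! ### Concentration of the number of blue nodes -/

lemma abs_covariance_indicator_le {Ω : Type*} [MeasurableSpace Ω] (μ : Measure Ω)
    [IsProbabilityMeasure μ] {A B : Set Ω} (hA : MeasurableSet A) (hB : MeasurableSet B) :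
    |cov[A.indicator 1, B.indicator 1; μ]| ≤ 1 := by
  have key : ∀ {D : Set Ω}, MeasurableSet D → ∀ ω,
      |D.indicator (1 : Ω → ℝ) ω - μ[D.indicator (1 : Ω → ℝ)]| ≤ 1 := by
    intro D hD ω
    rw [integral_indicator_one hD]
    have h0 : 0 ≤ μ.real D := measureReal_nonneg
    have h1 : μ.real D ≤ 1 := measureReal_le_one
    by_cases h : ω ∈ D <;> simp only [h, Set.indicator_of_mem, Set.indicator_of_notMem,
      not_false_eq_true, Pi.one_apply] <;> rw [abs_le] <;> constructor <;> linarith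
  have h := norm_integral_le_of_norm_le_const (μ := μ) (C := 1)
    (f := fun ω => (A.indicator (1 : Ω → ℝ) ω - μ[A.indicator (1 : Ω → ℝ)]) *
      (B.indicator (1 : Ω → ℝ) ω - μ[B.indicator (1 : Ω → ℝ)])) (.of_forall fun ω => by
        rw [Real.norm_eq_abs, abs_mul]
        exact mul_le_one₀ (key hA ω) (abs_nonneg _) (key hB ω))
  simpa [covariance] using h

/-- A sum of indicators has variance at most its number of terms times the maximal degree of their
dependency graph. -/
lemma variance_sum_indicator_le {Ω ι : Type*} [MeasurableSpace Ω] [Fintype ι] (μ : Measure Ω)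
    [IsProbabilityMeasure μ] {A : ι → Set Ω} (hA : ∀ i, MeasurableSet (A i)) (R : ι → ι → Prop)
    [∀ i, DecidablePred (R i)] (k : ℕ) (hk : ∀ i, (Finset.univ.filter (R i)).card ≤ k)
    (hR : ∀ i j, ¬ R i j →
      IndepFun ((A i).indicator (1 : Ω → ℝ)) ((A j).indicator (1 : Ω → ℝ)) μ) :
    Var[∑ i, (A i).indicator (1 : Ω → ℝ); μ] ≤ Fintype.card ι * k := by
  have hL : ∀ i, MemLp ((A i).indicator (1 : Ω → ℝ)) 2 μ := fun i =>
    memLp_indicator_const 2 (hA i) 1 (Or.inr (measure_ne_top μ _))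
  rw [variance_sum hL]
  have h : ∀ i, ∑ j, cov[(A i).indicator (1 : Ω → ℝ), (A j).indicator 1; μ] ≤ k := by
    intro i
    rw [← Finset.sum_filter_of_ne (p := R i)
      (fun j _ hne => by
        by_contra hij
        exact hne ((hR i j hij).covariance_eq_zero (hL i) (hL j)))]
    refine (Finset.sum_le_card_nsmul _ _ 1 fun j _ =>
      (abs_le.1 (abs_covariance_indicator_le μ (hA i) (hA j))).2).trans ?_
    simpa using hk i
  refine (Finset.sum_le_card_nsmul _ _ (k : ℝ) fun i _ => h i).trans ?_
  simp

/-- The nodes at distance at most `t` from `site m j`. -/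
def window (m t : ℕ) (j : ℤ) : Finset (Fin (m + 3)) :=
  (Finset.range (2 * t + 1)).image fun i : ℕ => site m (j - t + i)

lemma card_not_disjoint_window_le {m : ℕ} (t : ℕ) (l : Fin (m + 3) → ℤ)
    (hl : ∀ v, site m (l v) = v) (v : Fin (m + 3)) :
    (Finset.univ.filter
      fun w => ¬ Disjoint (window m t (l v)) (window m t (l w))).card ≤ 4 * t + 1 := by
  have hsub : (Finset.univ.filter
      fun w => ¬ Disjoint (window m t (l v)) (window m t (l w))) ⊆
      (Finset.range (4 * t + 1)).image fun d : ℕ => site m (l v - 2 * t + d) := by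
    intro w hw
    rw [Finset.mem_filter, Finset.not_disjoint_iff] at hw
    obtain ⟨-, u, hu, hu'⟩ := hw
    simp only [window, Finset.mem_image, Finset.mem_range] at hu hu'
    obtain ⟨i, hi, rfl⟩ := hu
    obtain ⟨j, hj, h⟩ := hu'
    rw [Finset.mem_image]
    refine ⟨2 * t + i - j, by rw [Finset.mem_range]; omega, ?_⟩
    rw [← hl w, site_eq_iff]
    rw [eq_comm, site_eq_iff] at h
    convert h using 1
    push_cast [show j ≤ 2 * t + i by omega]
    ring
  exact (Finset.card_le_card hsub).trans (Finset.card_image_le.trans (by simp))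

lemma indepFun_indicator_lineStep {m : ℕ} (p : unitInterval) (t : ℕ) {i j : ℤ}
    (hij : Disjoint (window m t i) (window m t j)) :
    IndepFun
      ({c : Coloring (Fin (m + 3)) | lineStep^[t] (unroll c) i = true}.indicator
        (1 : Coloring (Fin (m + 3)) → ℝ))
      ({c : Coloring (Fin (m + 3)) | lineStep^[t] (unroll c) j = true}.indicator
        (1 : Coloring (Fin (m + 3)) → ℝ)) (randomColoring (Fin (m + 3)) p) := by
  have hind := (randomColoring_iIndepFun (Fin (m + 3)) p).indepFun_finset _ _ hij
    (fun v => measurable_pi_apply v)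
  -- a colouring of a window, extended by white to the whole cycle
  let ext (k : ℤ) (y : window m t k → Bool) : Coloring (Fin (m + 3)) :=
    fun u => if h : u ∈ window m t k then y ⟨u, h⟩ else false
  let φ (k : ℤ) (y : window m t k → Bool) : ℝ :=
    {c : Coloring (Fin (m + 3)) | lineStep^[t] (unroll c) k = true}.indicator 1 (ext k y)
  have hφ : ∀ k, {c : Coloring (Fin (m + 3)) | lineStep^[t] (unroll c) k = true}.indicator
      (1 : Coloring (Fin (m + 3)) → ℝ) =
      φ k ∘ fun c (u : window m t k) => c u := by
    intro k
    funext c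
    have : lineStep^[t] (unroll c) k =
        lineStep^[t] (unroll (ext k fun u : window m t k => c u)) k := by
      refine lineStep_iterate_congr t _ _ k fun s h1 h2 => ?_
      have hs : site m s ∈ window m t k := by
        simp only [window, Finset.mem_image, Finset.mem_range]
        refine ⟨(s - (k - t)).toNat, by omega, ?_⟩
        congr 1
        omega
      simp [unroll, ext, hs]
    simp only [φ, Function.comp, Set.indicator_apply, Set.mem_ofPred_eq, this]
    rfl
  rw [hφ i, hφ j]
  exact hind.comp (measurable_of_finite _) (measurable_of_finite _)

lemma run_apply_site {m : ℕ} [DecidableRel (SimpleGraph.cycleGraph (m + 3)).Adj]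
    (c : Coloring (Fin (m + 3))) (t : ℕ) (j : ℤ) :
    run (SimpleGraph.cycleGraph (m + 3)) c t (site m j) = lineStep^[t] (unroll c) j :=
  congrFun (unroll_run c t) j

/-- Chebyshev's inequality for the number of blue nodes after `t` rounds, with the mean replaced by
its limit. -/
lemma randomColoring_blueCount_deviation_le {m : ℕ}
    [DecidableRel (SimpleGraph.cycleGraph (m + 3)).Adj] (p : unitInterval) (t : ℕ)
    (ht : 2 * t + 1 ≤ m + 3) {r : ℝ} (hr : 0 < r) :
    (randomColoring (Fin (m + 3)) p).real
      {c | r + (m + 3 : ℕ) * (1 / 4) ^ t ≤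
        |(blueCount (run (SimpleGraph.cycleGraph (m + 3)) c t) : ℝ) -
          blueDensity p * (m + 3 : ℕ)|} ≤ (m + 3 : ℕ) * (4 * t + 1) / r ^ 2 := by
  set μ := randomColoring (Fin (m + 3)) p
  choose l hl using exists_site_eq m
  let A (v : Fin (m + 3)) : Set (Coloring (Fin (m + 3))) :=
    {c | lineStep^[t] (unroll c) (l v) = true}
  have hA : ∀ v, MeasurableSet (A v) := fun v => (Set.toFinite _).measurableSet
  let Y : Coloring (Fin (m + 3)) → ℝ := ∑ v, (A v).indicator 1
  have hL : ∀ v, MemLp ((A v).indicator (1 : Coloring (Fin (m + 3)) → ℝ)) 2 μ := fun v =>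
    memLp_indicator_const 2 (hA v) 1 (Or.inr (measure_ne_top μ _))
  have hY : MemLp Y 2 μ := memLp_finsetSum' _ fun v _ => hL v
  have hcount : ∀ c, (blueCount (run (SimpleGraph.cycleGraph (m + 3)) c t) : ℝ) = Y c := by
    intro c
    have e : ∀ v, run (SimpleGraph.cycleGraph (m + 3)) c t v =
        lineStep^[t] (unroll c) (l v) := fun v => by rw [← run_apply_site, hl]
    simp only [blueCount, e, Y, A, Finset.sum_apply, Set.indicator_apply, Set.mem_ofPred_eq,
      Pi.one_apply, Finset.sum_boole]
  have hmean : |μ[Y] - blueDensity p * (m + 3 : ℕ)| ≤ (m + 3 : ℕ) * (1 / 4) ^ t := by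
    have e1 : μ[Y] = ∑ v, μ.real (A v) := by
      have : Y = fun c => ∑ v, (A v).indicator 1 c := by
        funext c; simp [Y]
      rw [this, integral_finsetSum _ fun v _ => (hL v).integrable (by norm_num)]
      exact Finset.sum_congr rfl fun v _ => integral_indicator_one (hA v)
    have e2 : blueDensity p * (m + 3 : ℕ) = ∑ _v : Fin (m + 3), blueDensity p := by
      simp [mul_comm]
    rw [e1, e2, ← Finset.sum_sub_distrib]
    refine (Finset.abs_sum_le_sum_abs _ _).trans ?_
    refine (Finset.sum_le_card_nsmul _ _ ((1 / 4) ^ t) fun v _ =>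
      abs_randomColoring_run_sub_le p (l v) t ht).trans (by simp)
  have hvar : Var[Y; μ] ≤ (m + 3 : ℕ) * (4 * t + 1) := by
    classical
    have := variance_sum_indicator_le μ hA
      (fun v w => ¬ Disjoint (window m t (l v)) (window m t (l w))) (4 * t + 1)
      (card_not_disjoint_window_le t l hl)
      (fun v w h => indepFun_indicator_lineStep p t (not_not.1 h))
    simpa using this
  have hsub : {c | r + (m + 3 : ℕ) * (1 / 4) ^ t ≤
        |(blueCount (run (SimpleGraph.cycleGraph (m + 3)) c t) : ℝ) -
          blueDensity p * (m + 3 : ℕ)|} ⊆ {c | r ≤ |Y c - μ[Y]|} := by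
    intro c hc
    rw [Set.mem_ofPred_eq, hcount] at hc
    have := abs_sub_le (Y c) μ[Y] (blueDensity p * (m + 3 : ℕ))
    rw [Set.mem_ofPred_eq]
    linarith
  refine (measureReal_mono hsub (measure_ne_top μ _)).trans ?_
  have hcheb := ENNReal.toReal_mono ENNReal.ofReal_ne_top (meas_ge_le_variance_div_sq hY hr)
  rw [ENNReal.toReal_ofReal (div_nonneg (variance_nonneg _ _) (by positivity))] at hcheb
  exact hcheb.trans (by gcongr)

end MajorityModel

/-! ### Logarithmic time -/

open MeasureTheory Filter Topology in
theorem mainTheorem1 :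
    ∃ C : ℝ, 0 < C ∧ ∀ ε : ℝ, 0 < ε → ∀ δ : ℝ, 0 < δ → ∃ N : ℕ, ∀ n : ℕ, N ≤ n →
      ∀ p : unitInterval, 1 / 2 ≤ (p : ℝ) →
        1 - δ ≤ (MajorityModel.randomColoring (Fin n) p).real
          {c : MajorityModel.Coloring (Fin n) | ∃ t : ℕ, (t : ℝ) ≤ C * Real.log (n : ℝ) ∧
            MajorityModel.IsStable (SimpleGraph.cycleGraph n)
              (MajorityModel.run (SimpleGraph.cycleGraph n) c t) ∧
            (1 - ε) * (MajorityModel.blueDensity (p : ℝ) * (n : ℝ)) ≤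
              (MajorityModel.blueCount
                (MajorityModel.run (SimpleGraph.cycleGraph n) c t) : ℝ) ∧
            (MajorityModel.blueCount
                (MajorityModel.run (SimpleGraph.cycleGraph n) c t) : ℝ) ≤
              (1 + ε) * (MajorityModel.blueDensity (p : ℝ) * (n : ℝ))} := by
  refine ⟨2, two_pos, fun ε hε δ hδ => ?_⟩
  have hinv : Tendsto (fun n : ℕ => 1 / (n : ℝ)) atTop (𝓝 0) :=
    tendsto_one_div_atTop_nhds_zero_nat
  have hlog : Tendsto (fun n : ℕ => Real.log n / (n : ℝ)) atTop (𝓝 0) :=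
    Real.isLittleO_log_id_atTop.tendsto_div_nhds_zero.comp tendsto_natCast_atTop_atTop
  have hfail : Tendsto (fun n : ℕ =>
      1 / (n : ℝ) + 16 / ε ^ 2 * (8 * (Real.log n / n) + 1 / n)) atTop (𝓝 0) := by
    simpa using hinv.add (((hlog.const_mul 8).add hinv).const_mul (16 / ε ^ 2))
  have hroom : Tendsto (fun n : ℕ => 4 * (Real.log n / n) + 3 * (1 / (n : ℝ))) atTop (𝓝 0) := by
    simpa using (hlog.const_mul 4).add (hinv.const_mul 3)
  obtain ⟨N, hN⟩ := eventually_atTop.1 ((eventually_ge_atTop 3).and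
    ((hfail.eventually_lt_const hδ).and ((hroom.eventually_lt_const one_pos).and
      (hinv.eventually_lt_const (show 0 < ε / 16 by positivity)))))
  refine ⟨N, fun n hn p hp => ?_⟩
  obtain ⟨hn3, hn1, hn2, hn4⟩ := hN n hn
  obtain ⟨m, rfl⟩ : ∃ m, n = m + 3 := ⟨n - 3, by omega⟩
  set x : ℝ := ((m + 3 : ℕ) : ℝ) with hx
  have hx3 : 3 ≤ x := by rw [hx]; exact_mod_cast hn3
  have hx0 : 0 < x := by linarith
  have hlog0 : 0 ≤ Real.log x := Real.log_nonneg (by linarith)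
  set t : ℕ := ⌊2 * Real.log x⌋₊
  have htle : (t : ℝ) ≤ 2 * Real.log x := Nat.floor_le (by linarith)
  have hlt : 2 * Real.log x < t + 1 := Nat.lt_floor_add_one _
  have hwin : 2 * t + 3 ≤ m + 3 := by
    have h1 : 4 * Real.log x + 3 < x := by
      have := mul_lt_mul_of_pos_right hn2 hx0
      have e : (4 * (Real.log x / x) + 3 * (1 / x)) * x = 4 * Real.log x + 3 := by field_simp
      linarith
    have h2 : ((2 * t + 3 : ℕ) : ℝ) ≤ ((m + 3 : ℕ) : ℝ) := by push_cast at hx ⊢; linarith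
    exact_mod_cast h2
  -- after `t` rounds the geometric error is below `n ^ (-2)`
  have hgeom : (1 / 4 : ℝ) ^ (t + 1) ≤ 1 / x ^ 2 := by
    have h1 : (1 / 4 : ℝ) ≤ Real.exp (-1) := by
      rw [Real.exp_neg, one_div]
      exact inv_anti₀ (Real.exp_pos _) (by linarith [Real.exp_one_lt_d9])
    calc (1 / 4 : ℝ) ^ (t + 1) ≤ Real.exp (-1) ^ (t + 1) := by gcongr
      _ = Real.exp (-((t : ℝ) + 1)) := by rw [← Real.exp_nat_mul]; push_cast; ring_nf
      _ ≤ Real.exp (-(2 * Real.log x)) := Real.exp_le_exp.2 (by linarith)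
      _ = 1 / x ^ 2 := by
        rw [Real.exp_neg, two_mul, Real.exp_add, Real.exp_log hx0, one_div, sq]
  set μ := MajorityModel.randomColoring (Fin (m + 3)) p
  set G := SimpleGraph.cycleGraph (m + 3)
  set U : Set (MajorityModel.Coloring (Fin (m + 3))) :=
    {c | ¬ MajorityModel.IsStable G (MajorityModel.run G c t)}
  set D : Set (MajorityModel.Coloring (Fin (m + 3))) :=
    {c | ε / 4 * x + x * (1 / 4) ^ t ≤
      |(MajorityModel.blueCount (MajorityModel.run G c t) : ℝ) - MajorityModel.blueDensity p * x|}
  have hU : μ.real U ≤ x * (1 / 4) ^ (t + 1) :=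
    MajorityModel.randomColoring_not_isStable_le p t hwin
  have hD : μ.real D ≤ x * (4 * t + 1) / (ε / 4 * x) ^ 2 :=
    MajorityModel.randomColoring_blueCount_deviation_le p t (by omega) (by positivity)
  have hUD : μ.real (U ∪ D) ≤ δ := by
    refine (measureReal_union_le _ _).trans ?_
    have h1 : x * (1 / 4) ^ (t + 1) ≤ 1 / x := by
      calc x * (1 / 4) ^ (t + 1) ≤ x * (1 / x ^ 2) := by gcongr
        _ = 1 / x := by field_simp
    have h2 : x * (4 * t + 1) / (ε / 4 * x) ^ 2 ≤
        16 / ε ^ 2 * (8 * (Real.log x / x) + 1 / x) := by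
      calc x * (4 * t + 1) / (ε / 4 * x) ^ 2
          ≤ x * (4 * (2 * Real.log x) + 1) / (ε / 4 * x) ^ 2 := by gcongr
        _ = 16 / ε ^ 2 * (8 * (Real.log x / x) + 1 / x) := by field_simp; ring
    linarith
  have hcompl : μ.real (U ∪ D)ᶜ = 1 - μ.real (U ∪ D) :=
    probReal_compl_eq_one_sub (Set.toFinite _).measurableSet
  refine (show 1 - δ ≤ μ.real (U ∪ D)ᶜ by linarith).trans
    (measureReal_mono (fun c hc => ?_) (measure_ne_top μ _))
  rw [Set.mem_compl_iff, Set.mem_union, not_or] at hc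
  obtain ⟨hcU, hcD⟩ := hc
  have hdev : |(MajorityModel.blueCount (MajorityModel.run G c t) : ℝ) -
      MajorityModel.blueDensity p * x| < ε / 4 * x + x * (1 / 4) ^ t := not_le.1 hcD
  have herr : x * (1 / 4) ^ t ≤ ε / 4 * x := by
    have h1 : (1 / 4 : ℝ) ^ t ≤ 4 * (1 / x ^ 2) := by
      rw [pow_succ] at hgeom; linarith
    have h2 : 1 / x ^ 2 ≤ 1 / x := one_div_le_one_div_of_le hx0 (by nlinarith)
    rw [mul_comm]
    exact mul_le_mul_of_nonneg_right (by linarith) hx0.le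
  -- the additive error becomes a relative one, as the limiting density is at least one half
  have hrel : ε * (1 / 2) * x ≤ ε * MajorityModel.blueDensity p * x := by
    have := MajorityModel.half_le_blueDensity p hp
    gcongr
  obtain ⟨h1, h2⟩ := abs_lt.1 hdev
  exact ⟨t, htle, not_not.1 hcU, by linarith, by linarith⟩
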